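/- Let $(X,Y)$ take values in $\mathbb R^p\times\mathbb R^q=\mathbb R^d$, $d=p+q$, with law $P$, and let $Z_1,Z_2,\dots$ be i.i.d. with law $P$. For $z_1,\dots,z_n\in\mathbb R^d$ let $\hat P_n$ be the empirical measure, and for a cell $A=A^1\times A^2$ put $\hat Q^*_n(A)=\hat P_n(A^1\times\mathbb R^q)\,\hat P_n(\mathbb R^p\times A^2)$. For $b_n>0$ the full tree $T^{full}_{b_n}$ is grown from the root cell $\mathbb R^d$. At a node with cell $A$ holding $m$ of the points a coordinate $i\in\{1,\dots,d\}$ is selected (by an arbitrary rule, possibly depending on $n$, the node and the data), and $t$ denotes the order statistic of rank $\lceil m/2\rceil$ of the $i$-th coordinates of the points in $A$; if both cells $\{z\in A: z(i)\le t\}$ and $\{z\in A: z(i)>t\}$ have $\hat P_n$-measure at least $b_n$, they become the children of the node, otherwise the node is a leaf. Write $T\ll T^{full}_{b_n}$ if $T$ is a pruned version (a subtree with the same root), $|T|$ for the number of leaves of $T$, and $\pi_T$ for the partition of $\mathbb R^d$ formed by the cells of the leaves of $T$. Let $$D_{\sigma(\pi_T)}(\hat P_n\|\hat Q_n^*)=\sum_{A\in\pi_T}\hat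 P_n(A)\log\frac{\hat P_n(A)}{\hat Q_n^*(A)},\qquad r_{b_n,\delta_n}(k)=\frac{24\sqrt2}{b_n\sqrt n}\sqrt{\ln\frac{8}{\delta_n b_n}+k\,[(d+1)\ln 2+d\ln n]},$$ where, for $k=1$, $r_{b_n,\delta_n}(1)$ may alternatively be set to $0$. Let $\hat T_{b_n,\delta_n}$ be any maximizer of $D_{\sigma(\pi_T)}(\hat P_n\|\hat Q^*_n)-r_{b_n,\delta_n}(|T|)$ over $T\ll T^{full}_{b_n}$, computed from $Z_1,\dots,Z_n$, and let $$\mathcal T_0=\sup\{m\ge1: |\hat T_{b_m,\delta_m}|>1\}\in\mathbb N\cup\{\infty\}\qquad(\sup\emptyset=0).$$ Assume that $b_n>0$ and $\delta_n>0$ for all $n\ge 1$, that $b_n\approx n^{-l}$ (same order: $c\,n^{-l}\le b_n\le C\,n^{-l}$ for all large $n$, with constants $0<c\le C$) for some $l\in(0,1/3)$, that $(\delta_n)\in\ell_1(\mathbb N)$ and that $1/\delta_n=O(e^{n^{1/3}})$. If $X$ and $Y$ are independent under $P$, i.e. $P(A\times B)=P(A\times\mathbb R^q)\,P(\mathbb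 R^p\times B)$ for all Borel sets $A,B$, then $\mathbb P(\mathcal T_0<\infty)=1$. Equivalently, almost surely the partition $\pi_{\hat T_{b_n,\delta_n}}$ equals $\{\mathbb R^d\}$ for all large $n$. -/

import Mathlib

open MeasureTheory ProbabilityTheory Filter Asymptotics
open scoped ENNReal

noncomputable section

namespace TSP

/-- A sample point `z = (x, y)` of `ℝ^p × ℝ^q = ℝ^d`, where `d = p + q`. -/
abbrev Pt (p q : ℕ) : Type := (Fin p → ℝ) × (Fin q → ℝ)

/-- The coordinate of `z = (x, y)` with index `i`, the index set being `{1..p} ⊔ {1..q}`. -/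
def coordVal {p q : ℕ} (z : Pt p q) (i : Fin p ⊕ Fin q) : ℝ := Sum.elim z.1 z.2 i

/-- `P ∈ 𝒫₀`: under `P` the two components are independent,
`P (A × B) = P (A × ℝ^q) * P (ℝ^p × B)` for all Borel sets `A` and `B`. -/
def IsIndependentLaw {p q : ℕ} (P : Measure (Pt p q)) : Prop :=
  ∀ (A : Set (Fin p → ℝ)) (B : Set (Fin q → ℝ)), MeasurableSet A → MeasurableSet B →
    P (A ×ˢ B) = P (Set.univ ×ˢ B) * P (A ×ˢ Set.univ)

/-- A cell with product structure `A = A₁ × A₂ ⊆ ℝ^p × ℝ^q`. -/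
@[ext] structure Cell (p q : ℕ) where
  /-- the factor in `ℝ^p` -/
  A₁ : Set (Fin p → ℝ)
  /-- the factor in `ℝ^q` -/
  A₂ : Set (Fin q → ℝ)

/-- The set `A₁ × A₂` of points of a cell. -/
def Cell.toSet {p q : ℕ} (A : Cell p q) : Set (Pt p q) := A.A₁ ×ˢ A.A₂

/-- The root cell `ℝ^d`. -/
def Cell.root (p q : ℕ) : Cell p q := ⟨Set.univ, Set.univ⟩

/-- The part of a cell where the coordinate with index `i` is at most `t`. -/
def Cell.below {p q : ℕ} (A : Cell p q) (i : Fin p ⊕ Fin q) (t : ℝ) : Cell p q :=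
  match i with
  | .inl i => ⟨{x ∈ A.A₁ | x i ≤ t}, A.A₂⟩
  | .inr i => ⟨A.A₁, {y ∈ A.A₂ | y i ≤ t}⟩

/-- The part of a cell where the coordinate with index `i` is greater than `t`. -/
def Cell.above {p q : ℕ} (A : Cell p q) (i : Fin p ⊕ Fin q) (t : ℝ) : Cell p q :=
  match i with
  | .inl i => ⟨{x ∈ A.A₁ | t < x i}, A.A₂⟩
  | .inr i => ⟨A.A₁, {y ∈ A.A₂ | t < y i}⟩

open Classical in
/-- The indices of the data points that lie in the set `S`. -/
def samplesIn {p q n : ℕ} (z : Fin n → Pt p q) (S : Set (Pt p q)) : Finset (Fin n) :=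
  Finset.univ.filter fun j => z j ∈ S

/-- The empirical probability `P̂_n(S) = (1/n) ∑ 1_S(z_j)`. -/
def empP {p q n : ℕ} (z : Fin n → Pt p q) (S : Set (Pt p q)) : ℝ :=
  ((samplesIn z S).card : ℝ) / n

/-- The empirical product probability
`Q̂*_n(A₁ × A₂) = P̂_n(A₁ × ℝ^q) * P̂_n(ℝ^p × A₂)`. -/
def empQ {p q n : ℕ} (z : Fin n → Pt p q) (A : Cell p q) : ℝ :=
  empP z (A.A₁ ×ˢ Set.univ) * empP z (Set.univ ×ˢ A.A₂)

/-- The empirical median of the coordinate `i` of the data in the cell `A`: if the cell holds `m ≥ 1`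
data points, the order statistic of rank `⌈m/2⌉` (which has position `(m - 1) / 2` in the increasingly
sorted list, positions being counted from `0`). -/
def median {p q n : ℕ} (z : Fin n → Pt p q) (A : Cell p q) (i : Fin p ⊕ Fin q) : ℝ :=
  (((samplesIn z A.toSet).val.map fun j => coordVal (z j) i).sort (· ≤ ·)).getD
    (((samplesIn z A.toSet).card - 1) / 2) 0

/-- The left child of the cell `A`, split at the median of the coordinate `i`. -/
def leftChild {p q n : ℕ} (z : Fin n → Pt p q) (A : Cell p q) (i : Fin p ⊕ Fin q) : Cell p q :=
  A.below i (median z A i)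

/-- The right child of the cell `A`, split at the median of the coordinate `i`. -/
def rightChild {p q n : ℕ} (z : Fin n → Pt p q) (A : Cell p q) (i : Fin p ⊕ Fin q) : Cell p q :=
  A.above i (median z A i)

theorem card_child_lt {p q n : ℕ} {b : ℝ} (z : Fin n → Pt p q) (A : Cell p q)
    (i : Fin p ⊕ Fin q)
    (h : 0 < b ∧ b ≤ empP z (leftChild z A i).toSet ∧ b ≤ empP z (rightChild z A i).toSet) :
    (samplesIn z (leftChild z A i).toSet).card < (samplesIn z A.toSet).card ∧
      (samplesIn z (rightChild z A i).toSet).card < (samplesIn z A.toSet).card := by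
  classical
  obtain ⟨hb, hl, hr⟩ := h
  have ne : ∀ S : Set (Pt p q), b ≤ empP z S → (samplesIn z S).Nonempty := by
    intro S hS
    rw [Finset.nonempty_iff_ne_empty]
    intro h0
    simp only [empP, h0, Finset.card_empty, Nat.cast_zero, zero_div] at hS
    exact absurd hb (not_lt.mpr hS)
  have lsub : (leftChild z A i).toSet ⊆ A.toSet := by
    rcases i with i | i <;> intro w hw <;>
      simp only [leftChild, Cell.below, Cell.toSet, Set.mem_prod, Set.mem_ofPred_eq] at hw ⊢ <;> tauto
  have rsub : (rightChild z A i).toSet ⊆ A.toSet := by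
    rcases i with i | i <;> intro w hw <;>
      simp only [rightChild, Cell.above, Cell.toSet, Set.mem_prod, Set.mem_ofPred_eq] at hw ⊢ <;> tauto
  have disj : ∀ w, w ∈ (leftChild z A i).toSet → w ∉ (rightChild z A i).toSet := by
    rcases i with i | i <;> intro w hw hw' <;>
      simp only [leftChild, rightChild, Cell.below, Cell.above, Cell.toSet, Set.mem_prod,
        Set.mem_ofPred_eq] at hw hw'
    · exact absurd hw.1.2 (not_le.mpr hw'.1.2)
    · exact absurd hw.2.2 (not_le.mpr hw'.2.2)
  obtain ⟨j, hj⟩ := ne _ hl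
  obtain ⟨k, hk⟩ := ne _ hr
  simp only [samplesIn, Finset.mem_filter, Finset.mem_univ, true_and] at hj hk
  constructor
  · refine Finset.card_lt_card (Finset.ssubset_iff_subset_ne.mpr ⟨?_, ?_⟩)
    · intro a ha
      simp only [samplesIn, Finset.mem_filter, Finset.mem_univ, true_and] at ha ⊢
      exact lsub ha
    · intro he
      have : k ∈ samplesIn z A.toSet := by
        simpa only [samplesIn, Finset.mem_filter, Finset.mem_univ, true_and] using rsub hk
      rw [← he] at this
      simp only [samplesIn, Finset.mem_filter, Finset.mem_univ, true_and] at this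
      exact disj _ this hk
  · refine Finset.card_lt_card (Finset.ssubset_iff_subset_ne.mpr ⟨?_, ?_⟩)
    · intro a ha
      simp only [samplesIn, Finset.mem_filter, Finset.mem_univ, true_and] at ha ⊢
      exact rsub ha
    · intro he
      have : j ∈ samplesIn z A.toSet := by
        simpa only [samplesIn, Finset.mem_filter, Finset.mem_univ, true_and] using lsub hj
      rw [← he] at this
      simp only [samplesIn, Finset.mem_filter, Finset.mem_univ, true_and] at this
      exact disj _ hj this

/- Trees are Mathlib's binary trees without data, `BinaryTree Unit`: `nil` is a single leaf, and
`node () l r` is an inner node with the two children `l` and `r`.  A node is addressed by the path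
that leads to it from the root, a list of Booleans with the last step first. -/

open Classical in
/-- The tree grown from the node `v` with cell `A`.  `coord v` is the coordinate that is selected for
splitting at the node `v`.  The cell is split at the median if both cells that this creates have
empirical probability at least `b`; otherwise the node is a leaf.  (The minimum `b` is positive in
all that follows, and this is what bounds the growth.) -/
def grow {p q n : ℕ} (b : ℝ) (z : Fin n → Pt p q) (coord : List Bool → Fin p ⊕ Fin q)
    (v : List Bool) (A : Cell p q) : BinaryTree Unit :=
  if _h : 0 < b ∧ b ≤ empP z (leftChild z A (coord v)).toSet ∧
      b ≤ empP z (rightChild z A (coord v)).toSet then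
    .node () (grow b z coord (false :: v) (leftChild z A (coord v)))
      (grow b z coord (true :: v) (rightChild z A (coord v)))
  else .nil
termination_by (samplesIn z A.toSet).card
decreasing_by
  · exact (card_child_lt z A (coord v) _h).1
  · exact (card_child_lt z A (coord v) _h).2

/-- The full tree `T^full_b`. -/
def fullTree {p q n : ℕ} (b : ℝ) (z : Fin n → Pt p q) (coord : List Bool → Fin p ⊕ Fin q) :
    BinaryTree Unit :=
  grow b z coord [] (Cell.root p q)

/-- `T ≪ F`: the tree `T` is a pruned version of `F`, that is, a subtree with the same root. -/
def IsPruned : BinaryTree Unit → BinaryTree Unit → Prop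
  | .nil, _ => True
  | .node _ l r, .node _ l' r' => IsPruned l l' ∧ IsPruned r r'
  | .node _ _ _, .nil => False

/-- The cells of the leaves of a tree whose root is the node `v` with cell `A`. -/
def cellsFrom {p q n : ℕ} (z : Fin n → Pt p q) (coord : List Bool → Fin p ⊕ Fin q) :
    BinaryTree Unit → List Bool → Cell p q → List (Cell p q)
  | .nil, _, A => [A]
  | .node _ l r, v, A =>
      cellsFrom z coord l (false :: v) (leftChild z A (coord v)) ++
        cellsFrom z coord r (true :: v) (rightChild z A (coord v))

/-- The data-driven partition `π_T` of `ℝ^d`: the cells of the leaves of `T`. -/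
def partition {p q n : ℕ} (z : Fin n → Pt p q) (coord : List Bool → Fin p ⊕ Fin q)
    (T : BinaryTree Unit) : List (Cell p q) :=
  cellsFrom z coord T [] (Cell.root p q)

/-- The empirical divergence `D_{σ(π_T)}(P̂_n ‖ Q̂*_n) = ∑_{A ∈ π_T} P̂_n(A) log (P̂_n(A) / Q̂*_n(A))`. -/
def empDiv {p q n : ℕ} (z : Fin n → Pt p q) (coord : List Bool → Fin p ⊕ Fin q)
    (T : BinaryTree Unit) : ℝ :=
  ((partition z coord T).map fun A =>
    empP z A.toSet * Real.log (empP z A.toSet / empQ z A)).sum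

/-- The threshold `ε_c(n, b, d, δ, k)`. -/
def epsC (n : ℕ) (b : ℝ) (d : ℕ) (δ : ℝ) (k : ℕ) : ℝ :=
  24 * √2 / (b * √n) * √(Real.log (8 / δ) + k * ((d + 1) * Real.log 2 + d * Real.log n))

/-- The penalty `r_{b, δ}(k) = ε_c(n, b, d, δ * b, k)` of the trees with `k` leaves. -/
def penalty (n : ℕ) (b : ℝ) (d : ℕ) (δ : ℝ) (k : ℕ) : ℝ := epsC n b d (δ * b) k

/-- `T` solves `max_{T ≪ T^full_b} D_{σ(π_T)}(P̂_n ‖ Q̂*_n) - r(|T|)`, where `|T|`, the size of a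
tree, is its number of leaves. -/
def IsSolution {p q n : ℕ} (b : ℝ) (r : ℕ → ℝ) (z : Fin n → Pt p q)
    (coord : List Bool → Fin p ⊕ Fin q) (T : BinaryTree Unit) : Prop :=
  IsPruned T (fullTree b z coord) ∧
    ∀ T', IsPruned T' (fullTree b z coord) →
      empDiv z coord T' - r T'.numLeaves ≤ empDiv z coord T - r T.numLeaves

/-- `𝒯₀ = sup {m ≥ 1 : |T_m| > 1} ∈ ℕ ∪ {∞}`, the last time at which the tree is not trivial (the
supremum of the empty set is `0`). -/
def lastNontrivial (T : ℕ → BinaryTree Unit) : ℕ∞ :=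
  sSup ((fun m : ℕ => (m : ℕ∞)) '' {m : ℕ | 1 ≤ m ∧ 1 < (T m).numLeaves})

/-- The first `n` terms of a sequence of sample points. -/
def initial {p q : ℕ} (z : ℕ → Pt p q) (n : ℕ) : Fin n → Pt p q := fun j => z j

end TSP

end

/-! Under independence the empirical divergence of a tree is a second-order quantity, while the
penalty grows by a larger amount with each leaf. All cells of the trees, and their two marginal
cylinders, are products of intervals. Bracketing this class with polynomially many sets, Hoeffding's
inequality and Borel–Cantelli give, almost surely and for all large `n`, a uniform deviation
`O(n^(-2/5))` of the empirical measure from `P` (`ae_eventually_abs_empP_box_sub_le`). Since `P` is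
a product on cells, the empirical measure and the empirical product measure then differ on every
cell by some `e = O(n^(-2/5))` (`abs_empP_sub_empQ_le`).

Now `log u ≤ u - 1` bounds each term of the divergence by a difference `x - y` plus `2 e² / b`. The
differences sum to `1 - 1 = 0` over the leaves, so a tree with `k` leaves has divergence at most `2
k e² / b`, which is of order `k n^(-4/5) / b` (`empDiv_le`).

The leaves have mass at least `b`, so `k ≤ 1 / b`. The radicand of the penalty is then `o(n^(3/5))`:
`log (1 / δ)` contributes `n^(1/3)`, and the other terms at most `n^l` up to logarithms. By
concavity of the square root, the penalty of `k` leaves exceeds that of one leaf by an arbitrarily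
large multiple of `k n^(-4/5) / b` (`le_penalty_sub_penalty`, `eventually_penalty_dominates`). Hence
eventually only the trivial tree is optimal. The failure probabilities are summable by their own
rate; of the summability of `δ` only `δ n → 0` is needed. -/

namespace TSP

/-! ### Bracketing of classes of sets and its stability under set operations -/

section Bracketing

variable {α β : Type*} [MeasurableSpace α] [MeasurableSpace β]

/-- The class `𝒜` is covered by at most `K` measurable brackets of `P`-width at most `η`. -/
def HasBrackets (P : Measure α) (𝒜 : Set (Set α)) (η : ℝ) (K : ℕ) : Prop :=
  ∃ F : Finset (Set α × Set α), F.card ≤ K ∧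
    (∀ B ∈ F, MeasurableSet B.1 ∧ MeasurableSet B.2 ∧ P.real (B.2 \ B.1) ≤ η) ∧
    ∀ A ∈ 𝒜, ∃ B ∈ F, B.1 ⊆ A ∧ A ⊆ B.2

theorem HasBrackets.mono {P : Measure α} {𝒜 ℬ : Set (Set α)} {η : ℝ} {K : ℕ}
    (h : HasBrackets P 𝒜 η K) (hs : ℬ ⊆ 𝒜) : HasBrackets P ℬ η K := by
  obtain ⟨F, hK, hF, hc⟩ := h
  exact ⟨F, hK, hF, fun A hA => hc A (hs hA)⟩

theorem HasBrackets.inter {P : Measure α} [IsFiniteMeasure P] {𝒜 ℬ : Set (Set α)} {η η' : ℝ}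
    {K K' : ℕ} (h : HasBrackets P 𝒜 η K) (h' : HasBrackets P ℬ η' K') :
    HasBrackets P (Set.image2 (· ∩ ·) 𝒜 ℬ) (η + η') (K * K') := by
  classical
  obtain ⟨F, hK, hF, hc⟩ := h
  obtain ⟨F', hK', hF', hc'⟩ := h'
  refine ⟨(F ×ˢ F').image fun g => (g.1.1 ∩ g.2.1, g.1.2 ∩ g.2.2), ?_, ?_, ?_⟩
  · exact Finset.card_image_le.trans (by rw [Finset.card_product]; exact Nat.mul_le_mul hK hK')
  · intro B hB
    obtain ⟨⟨g, g'⟩, hg, rfl⟩ := Finset.mem_image.1 hB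
    obtain ⟨hg, hg'⟩ := Finset.mem_product.1 hg
    obtain ⟨m1, m2, m3⟩ := hF g hg
    obtain ⟨m1', m2', m3'⟩ := hF' g' hg'
    refine ⟨m1.inter m1', m2.inter m2', ?_⟩
    calc P.real ((g.2 ∩ g'.2) \ (g.1 ∩ g'.1)) ≤ P.real ((g.2 \ g.1) ∪ (g'.2 \ g'.1)) := by
          refine measureReal_mono ?_
          intro x hx
          simp only [Set.mem_sdiff, Set.mem_inter_iff, Set.mem_union] at hx ⊢
          tauto
      _ ≤ _ := (measureReal_union_le _ _).trans (add_le_add m3 m3')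
  · rintro _ ⟨A, hA, A', hA', rfl⟩
    obtain ⟨g, hg, h1, h2⟩ := hc A hA
    obtain ⟨g', hg', h1', h2'⟩ := hc' A' hA'
    exact ⟨_, Finset.mem_image_of_mem _ (Finset.mk_mem_product hg hg'),
      Set.inter_subset_inter h1 h1', Set.inter_subset_inter h2 h2'⟩

theorem HasBrackets.compl {P : Measure α} {𝒜 : Set (Set α)} {η : ℝ} {K : ℕ}
    (h : HasBrackets P 𝒜 η K) : HasBrackets P (compl '' 𝒜) η K := by
  classical
  obtain ⟨F, hK, hF, hc⟩ := h
  refine ⟨F.image fun g => (g.2ᶜ, g.1ᶜ), Finset.card_image_le.trans hK, ?_, ?_⟩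
  · intro B hB
    obtain ⟨g, hg, rfl⟩ := Finset.mem_image.1 hB
    obtain ⟨m1, m2, m3⟩ := hF g hg
    refine ⟨m2.compl, m1.compl, ?_⟩
    have : g.1ᶜ \ g.2ᶜ = g.2 \ g.1 := by
      ext x
      simp only [Set.mem_sdiff, Set.mem_compl_iff]
      tauto
    rwa [this]
  · rintro _ ⟨A, hA, rfl⟩
    obtain ⟨g, hg, h1, h2⟩ := hc A hA
    exact ⟨_, Finset.mem_image_of_mem _ hg, Set.compl_subset_compl.2 h2, Set.compl_subset_compl.2 h1⟩

theorem HasBrackets.comap {P : Measure α} {f : α → β} (hf : Measurable f) {𝒜 : Set (Set β)}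
    {η : ℝ} {K : ℕ} (h : HasBrackets (P.map f) 𝒜 η K) :
    HasBrackets P (Set.preimage f '' 𝒜) η K := by
  classical
  obtain ⟨F, hK, hF, hc⟩ := h
  refine ⟨F.image fun g => (f ⁻¹' g.1, f ⁻¹' g.2), Finset.card_image_le.trans hK, ?_, ?_⟩
  · intro B hB
    obtain ⟨g, hg, rfl⟩ := Finset.mem_image.1 hB
    obtain ⟨m1, m2, m3⟩ := hF g hg
    refine ⟨hf m1, hf m2, ?_⟩
    rwa [map_measureReal_apply hf (m2.diff m1)] at m3
  · rintro _ ⟨A, hA, rfl⟩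
    obtain ⟨g, hg, h1, h2⟩ := hc A hA
    exact ⟨_, Finset.mem_image_of_mem _ hg, Set.preimage_mono h1, Set.preimage_mono h2⟩

theorem HasBrackets.iInter {ι : Type*} [Fintype ι] {P : Measure α} [IsFiniteMeasure P]
    {𝒜 : ι → Set (Set α)} {η : ℝ} {K : ℕ} (h : ∀ i, HasBrackets P (𝒜 i) η K) :
    HasBrackets P {S | ∃ A : ι → Set α, (∀ i, A i ∈ 𝒜 i) ∧ S = ⋂ i, A i}
      (Fintype.card ι * η) (K ^ Fintype.card ι) := by
  classical
  choose F hK hF hc using h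
  refine ⟨(Fintype.piFinset F).image fun g => (⋂ i, (g i).1, ⋂ i, (g i).2), ?_, ?_, ?_⟩
  · refine Finset.card_image_le.trans ?_
    rw [Fintype.card_piFinset]
    exact Finset.prod_le_pow_card _ _ _ fun i _ => hK i
  · intro B hB
    obtain ⟨g, hg, rfl⟩ := Finset.mem_image.1 hB
    have hg' := fun i => hF i (g i) (Fintype.mem_piFinset.1 hg i)
    refine ⟨.iInter fun i => (hg' i).1, .iInter fun i => (hg' i).2.1, ?_⟩
    calc P.real ((⋂ i, (g i).2) \ (⋂ i, (g i).1)) ≤ P.real (⋃ i, (g i).2 \ (g i).1) := by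
          refine measureReal_mono ?_
          intro x hx
          simp only [Set.mem_sdiff, Set.mem_iInter, Set.mem_iUnion, not_forall] at hx ⊢
          obtain ⟨hx, i, hi⟩ := hx
          exact ⟨i, hx i, hi⟩
      _ ≤ ∑ i, P.real ((g i).2 \ (g i).1) := measureReal_iUnion_fintype_le _
      _ ≤ ∑ _i : ι, η := Finset.sum_le_sum fun i _ => (hg' i).2.2
      _ = _ := by simp
  · rintro _ ⟨A, hA, rfl⟩
    choose g hg h1 h2 using fun i => hc i (A i) (hA i)
    exact ⟨_, Finset.mem_image_of_mem _ (Fintype.mem_piFinset.2 hg), Set.iInter_mono h1,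
      Set.iInter_mono h2⟩

end Bracketing

/-! ### Brackets for lower sets and intervals of the line -/

section Intervals

/-- The family may be uncountable. By inner regularity it suffices to bound compact subsets of the
union; the maximum of such a subset lies in one member, which then contains the whole subset. -/
theorem measure_sUnion_le_of_isLowerSet (P : Measure ℝ) [IsFiniteMeasure P] (𝒞 : Set (Set ℝ))
    (c : ℝ≥0∞) (hl : ∀ S ∈ 𝒞, IsLowerSet S) (hc : ∀ S ∈ 𝒞, P S ≤ c) : P (⋃₀ 𝒞) ≤ c := by
  have hU : IsLowerSet (⋃₀ 𝒞) := isLowerSet_sUnion hl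
  rw [hU.ordConnected.measurableSet.measure_eq_iSup_isCompact P]
  refine iSup₂_le fun K hK => iSup_le fun hKc => ?_
  rcases K.eq_empty_or_nonempty with rfl | hne
  · simp
  obtain ⟨x, hx, hmax⟩ := hKc.exists_isGreatest hne
  obtain ⟨S, hS, hxS⟩ := hK hx
  exact (measure_mono fun y hy => hl S hS (hmax hy) hxS).trans (hc S hS)

theorem measure_sUnion_le_of_isUpperSet (P : Measure ℝ) [IsFiniteMeasure P] (𝒞 : Set (Set ℝ))
    (c : ℝ≥0∞) (hl : ∀ S ∈ 𝒞, IsUpperSet S) (hc : ∀ S ∈ 𝒞, P S ≤ c) : P (⋃₀ 𝒞) ≤ c := by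
  have hU : IsUpperSet (⋃₀ 𝒞) := isUpperSet_sUnion hl
  rw [hU.ordConnected.measurableSet.measure_eq_iSup_isCompact P]
  refine iSup₂_le fun K hK => iSup_le fun hKc => ?_
  rcases K.eq_empty_or_nonempty with rfl | hne
  · simp
  obtain ⟨x, hx, hmin⟩ := hKc.exists_isLeast hne
  obtain ⟨S, hS, hxS⟩ := hK hx
  exact (measure_mono fun y hy => hl S hS (hmin hy) hxS).trans (hc S hS)

/-- The lower sets whose measure lies between `s` and `t` have a common bracket of width `t - s`. -/
theorem exists_bracket_isLowerSet (P : Measure ℝ) [IsProbabilityMeasure P] {s t : ℝ} (hst : s ≤ t) :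
    ∃ B : Set ℝ × Set ℝ, MeasurableSet B.1 ∧ MeasurableSet B.2 ∧ P.real (B.2 \ B.1) ≤ t - s ∧
      ∀ S, IsLowerSet S → s ≤ P.real S → P.real S ≤ t → B.1 ⊆ S ∧ S ⊆ B.2 := by
  -- With no lower set in this range any bracket will do. Otherwise the witness `S₀` ensures that
  -- the inner set below is contained in the outer one, which the computation of the width needs.
  by_cases hex : ∃ S, IsLowerSet S ∧ s ≤ P.real S ∧ P.real S ≤ t
  swap
  · refine ⟨(∅, ∅), .empty, .empty, by simpa using hst, fun S h1 h2 h3 => ?_⟩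
    exact absurd ⟨S, h1, h2, h3⟩ hex
  obtain ⟨S₀, hS₀, h1, h2⟩ := hex
  have ht0 : 0 ≤ t := measureReal_nonneg.trans h2
  have hs1 : 0 ≤ 1 - s := sub_nonneg.2 (h1.trans measureReal_le_one)
  -- The outer set is the union of all lower sets of measure at most `t`; the inner one is the
  -- complement of the union of all upper sets of measure at most `1 - s`. This is a quantile
  -- construction that tolerates atoms.
  let 𝒰 : Set (Set ℝ) := {S | IsLowerSet S ∧ P.real S ≤ t}
  let 𝒱 : Set (Set ℝ) := {S | IsUpperSet S ∧ P.real S ≤ 1 - s}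
  have hU : P.real (⋃₀ 𝒰) ≤ t := by
    refine ENNReal.toReal_le_of_le_ofReal ht0 ?_
    refine measure_sUnion_le_of_isLowerSet P 𝒰 _ (fun S hS => hS.1) fun S hS => ?_
    rw [← ofReal_measureReal]
    exact ENNReal.ofReal_le_ofReal hS.2
  have hV : P.real (⋃₀ 𝒱) ≤ 1 - s := by
    refine ENNReal.toReal_le_of_le_ofReal hs1 ?_
    refine measure_sUnion_le_of_isUpperSet P 𝒱 _ (fun S hS => hS.1) fun S hS => ?_
    rw [← ofReal_measureReal]
    exact ENNReal.ofReal_le_ofReal hS.2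
  have mU : MeasurableSet (⋃₀ 𝒰) :=
    (isLowerSet_sUnion fun S (hS : S ∈ 𝒰) => hS.1).ordConnected.measurableSet
  have mV : MeasurableSet (⋃₀ 𝒱) :=
    (isUpperSet_sUnion fun S (hS : S ∈ 𝒱) => hS.1).ordConnected.measurableSet
  have key : ∀ S, IsLowerSet S → s ≤ P.real S → P.real S ≤ t → (⋃₀ 𝒱)ᶜ ⊆ S ∧ S ⊆ ⋃₀ 𝒰 := by
    intro S hS hs ht
    refine ⟨?_, Set.subset_sUnion_of_mem ⟨hS, ht⟩⟩
    rw [Set.compl_subset_comm]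
    refine Set.subset_sUnion_of_mem ⟨hS.compl, ?_⟩
    rw [probReal_compl_eq_one_sub hS.ordConnected.measurableSet]
    linarith
  refine ⟨((⋃₀ 𝒱)ᶜ, ⋃₀ 𝒰), mV.compl, mU, ?_, key⟩
  obtain ⟨k1, k2⟩ := key S₀ hS₀ h1 h2
  rw [measureReal_sdiff (k1.trans k2) mV.compl, probReal_compl_eq_one_sub mV]
  linarith

theorem hasBrackets_isLowerSet (P : Measure ℝ) [IsProbabilityMeasure P] {N : ℕ} (hN : 0 < N) :
    HasBrackets P {S | IsLowerSet S} (1 / N) N := by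
  classical
  have hN' : (0 : ℝ) < N := by exact_mod_cast hN
  choose B hB using fun j : ℕ => exists_bracket_isLowerSet P
    (s := (j : ℝ) / N) (t := (j + 1) / N) (by gcongr; linarith)
  refine ⟨(Finset.range N).image B, ?_, ?_, ?_⟩
  · exact Finset.card_image_le.trans (Finset.card_range N).le
  · intro D hD
    obtain ⟨j, -, rfl⟩ := Finset.mem_image.1 hD
    obtain ⟨h1, h2, h3, -⟩ := hB j
    refine ⟨h1, h2, h3.trans (le_of_eq ?_)⟩
    field_simp
    ring
  · intro S hS
    have h0 : 0 ≤ P.real S * N := by positivity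
    have h1 : P.real S ≤ 1 := measureReal_le_one
    by_cases hlt : P.real S * N < N
    · refine ⟨B ⌊P.real S * N⌋₊, Finset.mem_image_of_mem _ ?_, (hB _).2.2.2 S hS ?_ ?_⟩
      · exact Finset.mem_range.2 ((Nat.floor_lt h0).2 hlt)
      · rw [div_le_iff₀ hN']
        exact Nat.floor_le h0
      · rw [le_div_iff₀ hN']
        exact (Nat.lt_floor_add_one _).le
    -- A set of full measure would have index `N`, out of range, so it is put into the last slice.
    · have h2 : P.real S = 1 := by
        refine le_antisymm h1 (le_of_mul_le_mul_right ?_ hN')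
        linarith
      refine ⟨B (N - 1), Finset.mem_image_of_mem _ (Finset.mem_range.2 (by omega)),
        (hB _).2.2.2 S hS ?_ ?_⟩
      · rw [h2, div_le_one hN']
        exact_mod_cast Nat.sub_le N 1
      · rw [h2, le_div_iff₀ hN', Nat.cast_sub hN]
        simp

/-- The intervals of the line, as differences of lower sets. -/
def intervals : Set (Set ℝ) :=
  Set.image2 (· ∩ ·) {S | IsLowerSet S} (compl '' {S | IsLowerSet S})

theorem univ_mem_intervals : Set.univ ∈ intervals :=
  ⟨Set.univ, isLowerSet_univ, Set.univ, ⟨∅, isLowerSet_empty, by simp⟩, by simp⟩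

theorem inter_Iic_mem_intervals {I : Set ℝ} (hI : I ∈ intervals) (t : ℝ) :
    I ∩ Set.Iic t ∈ intervals := by
  obtain ⟨S, hS, _, ⟨T, hT, rfl⟩, rfl⟩ := hI
  exact ⟨S ∩ Set.Iic t, hS.inter (isLowerSet_Iic t), Tᶜ, ⟨T, hT, rfl⟩, Set.inter_right_comm _ _ _⟩

theorem inter_Ioi_mem_intervals {I : Set ℝ} (hI : I ∈ intervals) (t : ℝ) :
    I ∩ Set.Ioi t ∈ intervals := by
  obtain ⟨S, hS, _, ⟨T, hT, rfl⟩, rfl⟩ := hI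
  refine ⟨S, hS, (T ∪ Set.Iic t)ᶜ, ⟨_, hT.union (isLowerSet_Iic t), rfl⟩, ?_⟩
  simp only [Set.compl_union, Set.compl_Iic, Set.inter_assoc]

theorem hasBrackets_intervals (P : Measure ℝ) [IsProbabilityMeasure P] {N : ℕ} (hN : 0 < N) :
    HasBrackets P intervals (1 / N + 1 / N) (N * N) :=
  (hasBrackets_isLowerSet P hN).inter (hasBrackets_isLowerSet P hN).compl

end Intervals

/-! ### Products of intervals, and the cells of the trees as such products -/

section Boxes

variable {p q : ℕ}

theorem measurable_coordVal (i : Fin p ⊕ Fin q) : Measurable fun z : Pt p q => coordVal z i := by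
  rcases i with i | i
  · exact (measurable_pi_apply i).comp measurable_fst
  · exact (measurable_pi_apply i).comp measurable_snd

/-- The products of intervals in `ℝ^d`. -/
def boxes (p q : ℕ) : Set (Set (Pt p q)) :=
  {S | ∃ I : Fin p ⊕ Fin q → Set ℝ, (∀ i, I i ∈ intervals) ∧
    S = ⋂ i, (fun z => coordVal z i) ⁻¹' I i}

/-- Bracketing the coordinate marginals separately gives width `O(1 / N)` with a number of brackets
polynomial in `N`, for an arbitrary law `P`. -/
theorem hasBrackets_boxes (P : Measure (Pt p q)) [IsProbabilityMeasure P] {N : ℕ} (hN : 0 < N) :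
    HasBrackets P (boxes p q) ((p + q) * (1 / N + 1 / N)) ((N * N) ^ (p + q)) := by
  have h := HasBrackets.iInter (P := P) fun i : Fin p ⊕ Fin q =>
    have := Measure.isProbabilityMeasure_map (μ := P) (measurable_coordVal i).aemeasurable
    (hasBrackets_intervals (P.map fun z => coordVal z i) hN).comap (measurable_coordVal i)
  simp only [Fintype.card_sum, Fintype.card_fin, Nat.cast_add] at h
  refine h.mono ?_
  rintro _ ⟨I, hI, rfl⟩
  exact ⟨_, fun i => ⟨I i, hI i, rfl⟩, rfl⟩

/-- A cell whose factors are products of intervals. -/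
def Cell.IsBox (A : Cell p q) : Prop :=
  ∃ I : Fin p ⊕ Fin q → Set ℝ, (∀ i, I i ∈ intervals) ∧
    A.A₁ = {x | ∀ i, x i ∈ I (.inl i)} ∧ A.A₂ = {y | ∀ i, y i ∈ I (.inr i)}

theorem Cell.IsBox.toSet_mem {A : Cell p q} (h : A.IsBox) : A.toSet ∈ boxes p q := by
  obtain ⟨I, hI, h1, h2⟩ := h
  refine ⟨I, hI, ?_⟩
  ext z
  simp [Cell.toSet, h1, h2, coordVal]

theorem Cell.isBox_root : (Cell.root p q).IsBox :=
  ⟨fun _ => Set.univ, fun _ => univ_mem_intervals, by simp [Cell.root], by simp [Cell.root]⟩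

/-- This and its counterpart `Cell.IsBox.snd` bring the marginal cylinders in `empQ` under the
uniform deviation bound. -/
theorem Cell.IsBox.fst {A : Cell p q} (h : A.IsBox) : (⟨A.A₁, Set.univ⟩ : Cell p q).IsBox := by
  obtain ⟨I, hI, h1, h2⟩ := h
  refine ⟨Sum.elim (fun i => I (.inl i)) fun _ => Set.univ, ?_, by simpa using h1, by simp⟩
  rintro (i | i)
  exacts [hI _, univ_mem_intervals]

theorem Cell.IsBox.snd {A : Cell p q} (h : A.IsBox) : (⟨Set.univ, A.A₂⟩ : Cell p q).IsBox := by
  obtain ⟨I, hI, h1, h2⟩ := h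
  refine ⟨Sum.elim (fun _ => Set.univ) fun i => I (.inr i), ?_, by simp, by simpa using h2⟩
  rintro (i | i)
  exacts [univ_mem_intervals, hI _]

theorem forall_mem_update_inter {ι κ : Type*} [DecidableEq κ] {e : ι → κ}
    (he : Function.Injective e) (I : κ → Set ℝ) (i : ι) (S : Set ℝ) (x : ι → ℝ) :
    (∀ j, x j ∈ Function.update I (e i) (I (e i) ∩ S) (e j)) ↔
      (∀ j, x j ∈ I (e j)) ∧ x i ∈ S := by
  constructor
  · intro h
    refine ⟨fun j => ?_, by simpa using (show x i ∈ I (e i) ∩ S by simpa using h i).2⟩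
    by_cases hj : j = i
    · subst hj
      exact (show x j ∈ I (e j) ∩ S by simpa using h j).1
    · simpa [he.ne hj] using h j
  · rintro ⟨h, hi⟩ j
    by_cases hj : j = i
    · subst hj
      simpa using ⟨h j, hi⟩
    · simpa [he.ne hj] using h j

theorem Cell.IsBox.restrict {A B : Cell p q} (h : A.IsBox) {i : Fin p ⊕ Fin q} {S : Set ℝ}
    (hS : ∀ I ∈ intervals, I ∩ S ∈ intervals)
    (hB : (∃ j, i = .inl j ∧ B = ⟨{x ∈ A.A₁ | x j ∈ S}, A.A₂⟩) ∨
      ∃ j, i = .inr j ∧ B = ⟨A.A₁, {y ∈ A.A₂ | y j ∈ S}⟩) : B.IsBox := by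
  classical
  obtain ⟨I, hI, h1, h2⟩ := h
  refine ⟨Function.update I i (I i ∩ S), fun j => ?_, ?_⟩
  · by_cases hj : j = i
    · subst hj
      simpa using hS _ (hI j)
    · simpa [hj] using hI j
  · rcases hB with ⟨j, rfl, rfl⟩ | ⟨j, rfl, rfl⟩
    · refine ⟨?_, by simpa using h2⟩
      simp only [forall_mem_update_inter Sum.inl_injective, h1, Set.mem_ofPred_eq]
    · refine ⟨by simpa using h1, ?_⟩
      simp only [forall_mem_update_inter Sum.inr_injective, h2, Set.mem_ofPred_eq]

theorem Cell.IsBox.below {A : Cell p q} (h : A.IsBox) (i : Fin p ⊕ Fin q) (t : ℝ) :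
    (A.below i t).IsBox := by
  refine h.restrict (i := i) (S := Set.Iic t) (fun I hI => inter_Iic_mem_intervals hI t) ?_
  rcases i with i | i
  exacts [.inl ⟨i, rfl, rfl⟩, .inr ⟨i, rfl, rfl⟩]

theorem Cell.IsBox.above {A : Cell p q} (h : A.IsBox) (i : Fin p ⊕ Fin q) (t : ℝ) :
    (A.above i t).IsBox := by
  refine h.restrict (i := i) (S := Set.Ioi t) (fun I hI => inter_Ioi_mem_intervals hI t) ?_
  rcases i with i | i
  exacts [.inl ⟨i, rfl, rfl⟩, .inr ⟨i, rfl, rfl⟩]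

end Boxes

end TSP

namespace TSP

/-! ### Uniform deviation of the empirical measure over boxes -/

section Deviation

variable {p q : ℕ} {Ω : Type*} [MeasurableSpace Ω]

theorem empP_initial (z : ℕ → Pt p q) (n : ℕ) (S : Set (Pt p q)) :
    empP (initial z n) S = (∑ i ∈ Finset.range n, S.indicator (fun _ => (1 : ℝ)) (z i)) / n := by
  classical
  rw [← Fin.sum_univ_eq_sum_range fun i => S.indicator (fun _ => (1 : ℝ)) (z i)]
  simp only [empP, samplesIn, initial, Set.indicator_apply, Finset.sum_boole]
  congr!

theorem empP_mono {n : ℕ} (z : Fin n → Pt p q) {S T : Set (Pt p q)} (h : S ⊆ T) :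
    empP z S ≤ empP z T := by
  classical
  unfold empP
  gcongr
  intro j
  simp only [samplesIn, Finset.mem_filter, Finset.mem_univ, true_and]
  exact fun hj => h hj

theorem abs_empP_sub_le_of_bracket {P : Measure (Pt p q)} [IsFiniteMeasure P] {n : ℕ}
    (z : Fin n → Pt p q) {L U A : Set (Pt p q)} {ε η : ℝ} (hL : L ⊆ A) (hU : A ⊆ U)
    (hη : P.real (U \ L) ≤ η) (h1 : |empP z L - P.real L| ≤ ε) (h2 : |empP z U - P.real U| ≤ ε) :
    |empP z A - P.real A| ≤ ε + η := by
  have hw : P.real U ≤ P.real L + η := by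
    calc P.real U ≤ P.real (L ∪ (U \ L)) := measureReal_mono (by simp)
      _ ≤ P.real L + P.real (U \ L) := measureReal_union_le _ _
      _ ≤ _ := by gcongr
  have a1 := empP_mono z hL
  have a2 := empP_mono z hU
  have a3 : P.real L ≤ P.real A := measureReal_mono hL
  have a4 : P.real A ≤ P.real U := measureReal_mono hU
  rw [abs_le] at *
  constructor <;> linarith

/-- Hoeffding's inequality: centred indicators are sub-Gaussian with parameter `1 / 4`, and the two
tails come from `X` and `-X`. -/
theorem measureReal_deviation_le {μ : Measure Ω} [IsProbabilityMeasure μ] {P : Measure (Pt p q)}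
    {Z : ℕ → Ω → Pt p q} (hZm : ∀ i, Measurable (Z i)) (hZi : iIndepFun Z μ)
    (hZP : ∀ i, μ.map (Z i) = P) {S : Set (Pt p q)} (hS : MeasurableSet S) {n : ℕ} (hn : 0 < n)
    {ε : ℝ} (hε : 0 ≤ ε) :
    μ.real {ω | ε ≤ |empP (initial (fun i => Z i ω) n) S - P.real S|} ≤
      2 * Real.exp (-2 * n * ε ^ 2) := by
  have hn' : (0 : ℝ) < n := by exact_mod_cast hn
  let f : Pt p q → ℝ := S.indicator fun _ => 1
  have hf : Measurable f := measurable_const.indicator hS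
  let X : ℕ → Ω → ℝ := fun i ω => f (Z i ω) - P.real S
  have hint : ∀ i, ∫ ω, f (Z i ω) ∂μ = P.real S := by
    intro i
    rw [← integral_map (hZm i).aemeasurable hf.aestronglyMeasurable, hZP i]
    simp only [f]
    rw [integral_indicator_const _ hS]
    simp
  have hX : ∀ i, HasSubgaussianMGF (X i) ((‖(1 : ℝ) - 0‖₊ / 2) ^ 2) μ := by
    intro i
    have := hasSubgaussianMGF_of_mem_Icc (X := fun ω => f (Z i ω)) (a := 0) (b := 1)
      (hf.comp (hZm i)).aemeasurable (μ := μ) (.of_forall fun ω => ?_)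
    · rwa [hint i] at this
    · by_cases h : Z i ω ∈ S <;> simp [f, h]
  have hXi : iIndepFun X μ :=
    hZi.comp (fun _ w => f w - P.real S) fun _ => hf.sub_const _
  have hXi' : iIndepFun (fun i => -X i) μ := hXi.comp (fun _ x => -x) fun _ => measurable_neg
  have hnε : 0 ≤ n * ε := by positivity
  have b1 := HasSubgaussianMGF.measure_sum_range_ge_le_of_iIndepFun hXi (n := n)
    (fun i _ => hX i) hnε
  have b2 := HasSubgaussianMGF.measure_sum_range_ge_le_of_iIndepFun hXi' (n := n)
    (fun i _ => (hX i).neg) hnε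
  have he : -((n : ℝ) * ε) ^ 2 / (2 * n * (((‖(1 : ℝ) - 0‖₊ / 2) ^ 2 : NNReal) : ℝ)) =
      -2 * n * ε ^ 2 := by
    simp
    field_simp
  rw [he] at b1 b2
  have hsum : ∀ ω, ∑ i ∈ Finset.range n, X i ω =
      n * (empP (initial (fun i => Z i ω) n) S - P.real S) := by
    intro ω
    rw [empP_initial]
    simp only [X, f, Finset.sum_sub_distrib, Finset.sum_const, Finset.card_range, nsmul_eq_mul]
    field_simp
  calc _ ≤ μ.real ({ω | n * ε ≤ ∑ i ∈ Finset.range n, X i ω} ∪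
        {ω | n * ε ≤ ∑ i ∈ Finset.range n, (-X i) ω}) := by
        refine measureReal_mono ?_
        intro ω hω
        simp only [Set.mem_union, Set.mem_ofPred_eq, Pi.neg_apply, Finset.sum_neg_distrib, hsum,
          ← mul_neg] at hω ⊢
        rcases le_abs.1 hω with h | h
        · exact .inl (mul_le_mul_of_nonneg_left h hn'.le)
        · exact .inr (mul_le_mul_of_nonneg_left h hn'.le)
    _ ≤ _ := measureReal_union_le _ _
    _ ≤ _ := add_le_add b1 b2
    _ = _ := by ring

/-- A union bound over the two ends of each bracket, followed by Borel–Cantelli. The exceptional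
events involve all of `𝒜` and need not be measurable; a bound on their outer measure is enough. -/
theorem ae_eventually_abs_empP_sub_le {μ : Measure Ω} [IsProbabilityMeasure μ]
    {P : Measure (Pt p q)} [IsFiniteMeasure P]
    {Z : ℕ → Ω → Pt p q} (hZm : ∀ i, Measurable (Z i)) (hZi : iIndepFun Z μ)
    (hZP : ∀ i, μ.map (Z i) = P) {𝒜 : Set (Set (Pt p q))} {η ε : ℕ → ℝ} {K : ℕ → ℕ}
    (h𝒜 : ∀ n, 0 < n → HasBrackets P 𝒜 (η n) (K n)) (hε : ∀ n, 0 ≤ ε n)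
    (hs : Summable fun n : ℕ => (K n : ℝ) * (4 * Real.exp (-2 * n * ε n ^ 2))) :
    ∀ᵐ ω ∂μ, ∀ᶠ n : ℕ in atTop, ∀ A ∈ 𝒜,
      |empP (initial (fun i => Z i ω) n) A - P.real A| ≤ ε n + η n := by
  let bad : ℕ → Set Ω := fun n =>
    {ω | 0 < n ∧ ∃ A ∈ 𝒜, ε n + η n < |empP (initial (fun i => Z i ω) n) A - P.real A|}
  have hbad : ∀ n, μ (bad n) ≤ ENNReal.ofReal (K n * (4 * Real.exp (-2 * n * ε n ^ 2))) := by
    intro n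
    rcases Nat.eq_zero_or_pos n with rfl | hn
    · simp [bad]
    obtain ⟨F, hK, hF, hc⟩ := h𝒜 n hn
    let dev : Set (Pt p q) → Set Ω := fun S =>
      {ω | ε n ≤ |empP (initial (fun i => Z i ω) n) S - P.real S|}
    have hsub : bad n ⊆ ⋃ B ∈ F, dev B.1 ∪ dev B.2 := by
      rintro ω ⟨-, A, hA, hlt⟩
      obtain ⟨B, hB, hL, hU⟩ := hc A hA
      refine Set.mem_iUnion₂.2 ⟨B, hB, ?_⟩
      by_contra hcon
      simp only [dev, Set.mem_union, Set.mem_ofPred_eq, not_or, not_le] at hcon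
      exact absurd hlt (not_lt.2 (abs_empP_sub_le_of_bracket _ hL hU (hF B hB).2.2
        hcon.1.le hcon.2.le))
    rw [← ofReal_measureReal]
    refine ENNReal.ofReal_le_ofReal ?_
    calc μ.real (bad n) ≤ μ.real (⋃ B ∈ F, dev B.1 ∪ dev B.2) :=
          measureReal_mono hsub (measure_ne_top _ _)
      _ ≤ ∑ B ∈ F, μ.real (dev B.1 ∪ dev B.2) := measureReal_biUnion_finset_le _ _
      _ ≤ ∑ _B ∈ F, 4 * Real.exp (-2 * n * ε n ^ 2) := by
          refine Finset.sum_le_sum fun B hB => ?_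
          have h1 := measureReal_deviation_le hZm hZi hZP (hF B hB).1 hn (hε n)
          have h2 := measureReal_deviation_le hZm hZi hZP (hF B hB).2.1 hn (hε n)
          refine (measureReal_union_le _ _).trans ((add_le_add h1 h2).trans (le_of_eq ?_))
          ring
      _ = F.card * (4 * Real.exp (-2 * n * ε n ^ 2)) := by rw [Finset.sum_const, nsmul_eq_mul]
      _ ≤ _ := by gcongr
  have hfin : ∑' n, μ (bad n) ≠ ∞ :=
    ne_top_of_le_ne_top hs.tsum_ofReal_ne_top (ENNReal.tsum_le_tsum hbad)
  filter_upwards [ae_eventually_notMem hfin] with ω hω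
  filter_upwards [hω, eventually_gt_atTop 0] with n hn hpos A hA
  by_contra hcon
  exact hn ⟨hpos, A, hA, not_le.1 hcon⟩

theorem summable_pow_mul_exp_neg_rpow (k : ℕ) :
    Summable fun n : ℕ => (((n * n) ^ k : ℕ) : ℝ) *
      (4 * Real.exp (-2 * n * ((n : ℝ) ^ (-(2 / 5) : ℝ)) ^ 2)) := by
  have hx : Tendsto (fun n : ℕ => (n : ℝ) ^ (1 / 5 : ℝ)) atTop atTop :=
    (tendsto_rpow_atTop (by norm_num)).comp tendsto_natCast_atTop_atTop
  -- With `x = n^(1/5)`, which equals `n ε²` for `ε = n^(-2/5)`, the power `x^(10 k + 10)` is `n^(2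
  -- k) * n²`: the number of brackets times a factor that leaves the summable `n^(-2)`.
  have h0 := (tendsto_rpow_mul_exp_neg_mul_atTop_nhds_zero (10 * k + 10) 2 (by norm_num)).comp hx
  have h1 : (fun n : ℕ => (((n * n) ^ k : ℕ) : ℝ) *
      (4 * Real.exp (-2 * n * ((n : ℝ) ^ (-(2 / 5) : ℝ)) ^ 2))) =O[atTop]
      fun n : ℕ => (n : ℝ) ^ (-2 : ℝ) := by
    refine IsBigO.of_bound 4 ?_
    filter_upwards [h0.eventually_le_const one_pos, eventually_gt_atTop 0] with n hn hpos
    have hn0 : (0 : ℝ) < n := by exact_mod_cast hpos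
    simp only [Function.comp_apply] at hn
    have e1 : ((n : ℝ) ^ (1 / 5 : ℝ)) ^ (10 * (k : ℝ) + 10) = (n : ℝ) ^ (2 * k) * (n : ℝ) ^ 2 := by
      rw [← Real.rpow_mul hn0.le, ← Real.rpow_natCast, ← Real.rpow_natCast, ← Real.rpow_add hn0]
      congr 1
      push_cast
      ring
    have e2 : (n : ℝ) * ((n : ℝ) ^ (-(2 / 5) : ℝ)) ^ 2 = (n : ℝ) ^ (1 / 5 : ℝ) := by
      rw [← Real.rpow_natCast, ← Real.rpow_mul hn0.le]
      nth_rewrite 1 [← Real.rpow_one (n : ℝ)]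
      rw [← Real.rpow_add hn0]
      norm_num
    rw [e1] at hn
    rw [mul_assoc (-2 : ℝ), e2, Real.norm_of_nonneg (by positivity),
      Real.norm_of_nonneg (by positivity), Real.rpow_neg hn0.le, Real.rpow_two]
    rw [← div_eq_mul_inv, le_div_iff₀ (by positivity)]
    push_cast
    calc _ = 4 * ((n : ℝ) ^ (2 * k) * (n : ℝ) ^ 2 * Real.exp (-2 * (n : ℝ) ^ (1 / 5 : ℝ))) := by
          rw [pow_mul, pow_two]
          ring
      _ ≤ 4 * 1 := by gcongr
      _ = 4 := by norm_num
  exact summable_of_isBigO_nat (Real.summable_nat_rpow.2 (by norm_num)) h1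

theorem ae_eventually_abs_empP_box_sub_le {μ : Measure Ω} [IsProbabilityMeasure μ]
    {P : Measure (Pt p q)} [IsProbabilityMeasure P]
    {Z : ℕ → Ω → Pt p q} (hZm : ∀ i, Measurable (Z i)) (hZi : iIndepFun Z μ)
    (hZP : ∀ i, μ.map (Z i) = P) :
    ∀ᵐ ω ∂μ, ∀ᶠ n : ℕ in atTop, ∀ A ∈ boxes p q,
      |empP (initial (fun i => Z i ω) n) A - P.real A| ≤
        (n : ℝ) ^ (-(2 / 5) : ℝ) + (p + q) * (1 / n + 1 / n) :=
  ae_eventually_abs_empP_sub_le hZm hZi hZP (K := fun n => (n * n) ^ (p + q))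
    (fun _ hn => hasBrackets_boxes P hn) (fun n => by positivity)
    (summable_pow_mul_exp_neg_rpow (p + q))

end Deviation

end TSP

namespace TSP

/-! ### Divergence of pruned trees and triviality of the solution -/

section Trees

variable {p q n : ℕ}

theorem empP_union (z : Fin n → Pt p q) {S T : Set (Pt p q)} (h : Disjoint S T) :
    empP z (S ∪ T) = empP z S + empP z T := by
  classical
  have hu : samplesIn z (S ∪ T) = samplesIn z S ∪ samplesIn z T := by
    ext j
    simp [samplesIn]
  have hd : Disjoint (samplesIn z S) (samplesIn z T) := by
    rw [Finset.disjoint_left]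
    intro j hS hT
    simp only [samplesIn, Finset.mem_filter, Finset.mem_univ, true_and] at hS hT
    exact Set.disjoint_left.1 h hS hT
  simp only [empP, hu, Finset.card_union_of_disjoint hd, Nat.cast_add, add_div]

theorem empP_univ (hn : 0 < n) (z : Fin n → Pt p q) : empP z Set.univ = 1 := by
  have : (n : ℝ) ≠ 0 := by exact_mod_cast hn.ne'
  simp [empP, samplesIn, this]

theorem empP_root (hn : 0 < n) (z : Fin n → Pt p q) : empP z (Cell.root p q).toSet = 1 := by
  simpa [Cell.toSet, Cell.root] using empP_univ hn z

theorem empQ_root (hn : 0 < n) (z : Fin n → Pt p q) : empQ z (Cell.root p q) = 1 := by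
  simp [empQ, Cell.root, empP_univ hn z]

theorem sep_le_union_sep_gt {α : Type*} (S : Set α) (f : α → ℝ) (t : ℝ) :
    {x ∈ S | f x ≤ t} ∪ {x ∈ S | t < f x} = S := by
  ext x
  simp only [Set.mem_union, Set.mem_ofPred_eq, ← and_or_left, le_or_gt, and_true]

theorem disjoint_sep_le_sep_gt {α : Type*} (S : Set α) (f : α → ℝ) (t : ℝ) :
    Disjoint {x ∈ S | f x ≤ t} {x ∈ S | t < f x} :=
  Set.disjoint_left.2 fun _ h1 h2 => absurd h1.2 (not_le.2 h2.2)

theorem empP_prod_split_left (z : Fin n → Pt p q) (S : Set (Fin p → ℝ)) (T : Set (Fin q → ℝ))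
    (f : (Fin p → ℝ) → ℝ) (t : ℝ) :
    empP z (S ×ˢ T) = empP z ({x ∈ S | f x ≤ t} ×ˢ T) + empP z ({x ∈ S | t < f x} ×ˢ T) := by
  rw [← empP_union z (Set.disjoint_prod.2 (.inl (disjoint_sep_le_sep_gt S f t))), ← Set.union_prod,
    sep_le_union_sep_gt]

theorem empP_prod_split_right (z : Fin n → Pt p q) (S : Set (Fin p → ℝ)) (T : Set (Fin q → ℝ))
    (f : (Fin q → ℝ) → ℝ) (t : ℝ) :
    empP z (S ×ˢ T) = empP z (S ×ˢ {y ∈ T | f y ≤ t}) + empP z (S ×ˢ {y ∈ T | t < f y}) := by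
  rw [← empP_union z (Set.disjoint_prod.2 (.inr (disjoint_sep_le_sep_gt T f t))), ← Set.prod_union,
    sep_le_union_sep_gt]

theorem empP_split (z : Fin n → Pt p q) (A : Cell p q) (i : Fin p ⊕ Fin q) (t : ℝ) :
    empP z A.toSet = empP z (A.below i t).toSet + empP z (A.above i t).toSet := by
  rcases i with i | i
  · exact empP_prod_split_left z A.A₁ A.A₂ (fun x => x i) t
  · exact empP_prod_split_right z A.A₁ A.A₂ (fun y => y i) t

theorem empQ_split (z : Fin n → Pt p q) (A : Cell p q) (i : Fin p ⊕ Fin q) (t : ℝ) :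
    empQ z A = empQ z (A.below i t) + empQ z (A.above i t) := by
  rcases i with i | i
  · simp only [empQ, Cell.below, Cell.above]
    rw [empP_prod_split_left z A.A₁ Set.univ (fun x => x i) t]
    ring
  · simp only [empQ, Cell.below, Cell.above]
    rw [empP_prod_split_right z Set.univ A.A₂ (fun y => y i) t]
    ring

variable (z : Fin n → Pt p q) (coord : List Bool → Fin p ⊕ Fin q)

theorem length_cellsFrom (T : BinaryTree Unit) (v : List Bool) (A : Cell p q) :
    (cellsFrom z coord T v A).length = T.numLeaves := by
  induction T generalizing v A with
  | nil => simp [cellsFrom]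
  | node _ l r hl hr => simp [cellsFrom, hl, hr]

/-- Used with the difference of `empP` and `empQ`, to cancel the first-order terms of the
divergence, and with `empP` alone, to count leaves. -/
theorem sum_map_cellsFrom {f : Cell p q → ℝ}
    (hf : ∀ A i t, f A = f (A.below i t) + f (A.above i t))
    (T : BinaryTree Unit) (v : List Bool) (A : Cell p q) :
    ((cellsFrom z coord T v A).map f).sum = f A := by
  induction T generalizing v A with
  | nil => simp [cellsFrom]
  | node _ l r hl hr =>
    rw [cellsFrom, List.map_append, List.sum_append, hl, hr]
    exact (hf _ _ _).symm

theorem isBox_of_mem_cellsFrom (T : BinaryTree Unit) (v : List Bool) {A : Cell p q}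
    (hA : A.IsBox) {C : Cell p q} (hC : C ∈ cellsFrom z coord T v A) : C.IsBox := by
  induction T generalizing v A with
  | nil =>
    rw [cellsFrom, List.mem_singleton] at hC
    exact hC ▸ hA
  | node _ l r hl hr =>
    rw [cellsFrom, List.mem_append] at hC
    rcases hC with hC | hC
    · exact hl _ (hA.below _ _) hC
    · exact hr _ (hA.above _ _) hC

theorem le_empP_of_mem_cellsFrom {b : ℝ} (T : BinaryTree Unit) (v : List Bool) {A : Cell p q}
    (hA : b ≤ empP z A.toSet) (hT : IsPruned T (grow b z coord v A)) {C : Cell p q}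
    (hC : C ∈ cellsFrom z coord T v A) : b ≤ empP z C.toSet := by
  induction T generalizing v A with
  | nil =>
    rw [cellsFrom, List.mem_singleton] at hC
    exact hC ▸ hA
  | node _ l r hl hr =>
    rw [grow] at hT
    split_ifs at hT with h
    · rw [cellsFrom, List.mem_append] at hC
      rcases hC with hC | hC
      · exact hl _ h.2.1 hT.1 hC
      · exact hr _ h.2.2 hT.2 hC
    · exact hT.elim

variable {b e : ℝ} {T : BinaryTree Unit}

/-- The first-order part `x - y` is kept exact because it cancels in the sum over leaves. The
remainder is `(x - y)² / y`, where `y ≥ b / 2`. -/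
theorem mul_log_div_le {x y b e : ℝ} (hb : 0 < b) (hx : b ≤ x) (hxy : |x - y| ≤ e)
    (he : e ≤ b / 2) : x * Real.log (x / y) ≤ (x - y) + 2 * e ^ 2 / b := by
  have h := abs_le.1 hxy
  have hx0 : 0 < x := hb.trans_le hx
  have hy : b / 2 ≤ y := by linarith
  have hy0 : 0 < y := by linarith
  have hsq : (x - y) ^ 2 ≤ e ^ 2 := sq_le_sq' h.1 h.2
  calc x * Real.log (x / y) ≤ x * (x / y - 1) := by
        gcongr
        exact Real.log_le_sub_one_of_pos (by positivity)
    _ = (x - y) + (x - y) ^ 2 / y := by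
        field_simp
        ring
    _ ≤ (x - y) + e ^ 2 / (b / 2) := by gcongr
    _ = _ := by
        field_simp

theorem empDiv_le (hn : 0 < n) (hb : 0 < b) (hb1 : b ≤ 1) (he : e ≤ b / 2)
    (hdev : ∀ A : Cell p q, A.IsBox → |empP z A.toSet - empQ z A| ≤ e)
    (hT : IsPruned T (fullTree b z coord)) :
    empDiv z coord T ≤ T.numLeaves * (2 * e ^ 2 / b) := by
  have hroot : b ≤ empP z (Cell.root p q).toSet := (empP_root hn z).symm ▸ hb1
  have hsum : ((partition z coord T).map fun A => empP z A.toSet - empQ z A).sum = 0 := by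
    rw [partition, sum_map_cellsFrom (f := fun A => empP z A.toSet - empQ z A) z coord, empP_root hn,
      empQ_root hn, sub_self]
    intro A i t
    rw [empP_split z A i t, empQ_split z A i t]
    ring
  calc empDiv z coord T
      ≤ ((partition z coord T).map fun A => (empP z A.toSet - empQ z A) + 2 * e ^ 2 / b).sum := by
        refine List.sum_le_sum fun A hA => ?_
        exact mul_log_div_le hb (le_empP_of_mem_cellsFrom z coord T [] hroot hT hA)
          (hdev A (isBox_of_mem_cellsFrom z coord T [] Cell.isBox_root hA)) he
    _ = T.numLeaves * (2 * e ^ 2 / b) := by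
        rw [List.sum_map_add, hsum, zero_add, List.map_const', List.sum_replicate, nsmul_eq_mul,
          partition, length_cellsFrom]

/-- The leaves share total mass one, and each holds at least `b`. -/
theorem numLeaves_mul_le_one (hn : 0 < n) (hb1 : b ≤ 1) (hT : IsPruned T (fullTree b z coord)) :
    T.numLeaves * b ≤ 1 := by
  have hroot : b ≤ empP z (Cell.root p q).toSet := (empP_root hn z).symm ▸ hb1
  have hsum := sum_map_cellsFrom (f := fun A => empP z A.toSet) z coord (empP_split z) T []
    (Cell.root p q)
  rw [empP_root hn] at hsum
  rw [← hsum, ← length_cellsFrom z coord T [] (Cell.root p q), ← nsmul_eq_mul]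
  have := List.card_nsmul_le_sum ((cellsFrom z coord T [] (Cell.root p q)).map
    fun A => empP z A.toSet) b fun x hx => by
      obtain ⟨A, hA, rfl⟩ := List.mem_map.1 hx
      exact le_empP_of_mem_cellsFrom z coord T [] hroot hT hA
  simpa using this

theorem empDiv_nil (hn : 0 < n) : empDiv z coord .nil = 0 := by
  simp [empDiv, partition, cellsFrom, empP_root hn, empQ_root hn]

theorem eq_nil_of_numLeaves_le_one (hT : T.numLeaves ≤ 1) : T = .nil := by
  cases T with
  | nil => rfl
  | node _ l r =>
    have h1 := l.numLeaves_pos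
    have h2 := r.numLeaves_pos
    simp only [BinaryTree.numLeaves] at hT
    omega

/-- If the penalty of each larger tree beats the bound of `empDiv_le`, the trivial tree is the only
solution. -/
theorem IsSolution.eq_nil {r : ℕ → ℝ} (hn : 0 < n) (hb : 0 < b) (hb1 : b ≤ 1) (he : e ≤ b / 2)
    (hdev : ∀ A : Cell p q, A.IsBox → |empP z A.toSet - empQ z A| ≤ e)
    (hr : ∀ k : ℕ, 2 ≤ k → k * b ≤ 1 → k * (2 * e ^ 2 / b) < r k - r 1)
    (hT : IsSolution b r z coord T) : T = .nil := by
  refine eq_nil_of_numLeaves_le_one ?_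
  by_contra! hk
  have h1 := hr _ hk (numLeaves_mul_le_one z coord hn hb1 hT.1)
  have h2 := empDiv_le z coord hn hb hb1 he hdev hT.1
  have h3 := hT.2 .nil (by simp [IsPruned])
  rw [empDiv_nil z coord hn, BinaryTree.numLeaves] at h3
  linarith

/-- One `ε` is paid for the cell and one for each of its marginal cylinders, since `P` factorizes on
the cell. -/
theorem abs_empP_sub_empQ_le {P : Measure (Pt p q)} [IsProbabilityMeasure P]
    (hP : IsIndependentLaw P) {ε : ℝ} (hn : 0 < n)
    (hdev : ∀ S ∈ boxes p q, |empP z S - P.real S| ≤ ε) {A : Cell p q} (hA : A.IsBox) :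
    |empP z A.toSet - empQ z A| ≤ 3 * ε := by
  have hA₁ : MeasurableSet A.A₁ ∧ MeasurableSet A.A₂ := by
    obtain ⟨I, hI, h1, h2⟩ := hA
    have hm : ∀ i, MeasurableSet (I i) := by
      intro i
      obtain ⟨S, hS, _, ⟨T, hT, rfl⟩, h⟩ := hI i
      rw [← h]
      exact hS.ordConnected.measurableSet.inter hT.ordConnected.measurableSet.compl
    rw [h1, h2]
    simp only [Set.ofPred_forall]
    exact ⟨.iInter fun i => measurable_pi_apply i (hm _),
      .iInter fun i => measurable_pi_apply i (hm _)⟩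
  have hprod : P.real A.toSet = P.real (A.A₁ ×ˢ Set.univ) * P.real (Set.univ ×ˢ A.A₂) := by
    rw [Cell.toSet, measureReal_def, hP _ _ hA₁.1 hA₁.2, ENNReal.toReal_mul, mul_comm]
    rfl
  have h0 := abs_le.1 (hdev _ hA.toSet_mem)
  have h1 := hdev _ hA.fst.toSet_mem
  have h2 := hdev _ hA.snd.toSet_mem
  simp only [Cell.toSet] at h1 h2
  have hle : empP z (A.A₁ ×ˢ Set.univ) ≤ 1 := empP_univ hn z ▸ empP_mono z (Set.subset_univ _)
  have h0' : 0 ≤ empP z (A.A₁ ×ˢ (Set.univ : Set (Fin q → ℝ))) := by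
    unfold empP
    positivity
  have hle' : P.real ((Set.univ : Set (Fin p → ℝ)) ×ˢ A.A₂) ≤ 1 := measureReal_le_one
  have h0'' : 0 ≤ P.real ((Set.univ : Set (Fin p → ℝ)) ×ˢ A.A₂) := measureReal_nonneg
  have hε : 0 ≤ ε := (abs_nonneg _).trans h1
  -- Here `a` is an empirical and `d` a true marginal probability, so each error is multiplied by a
  -- factor in `[0, 1]`.
  have key : ∀ a b c d : ℝ, 0 ≤ a → a ≤ 1 → 0 ≤ d → d ≤ 1 → |a - c| ≤ ε → |b - d| ≤ ε →
      |a * b - c * d| ≤ 2 * ε := by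
    intro a b c d ha ha' hd hd' h1 h2
    calc |a * b - c * d| = |a * (b - d) + (a - c) * d| := by ring_nf
      _ ≤ |a * (b - d)| + |(a - c) * d| := abs_add_le _ _
      _ = a * |b - d| + |a - c| * d := by rw [abs_mul, abs_mul, abs_of_nonneg ha, abs_of_nonneg hd]
      _ ≤ 1 * ε + ε * 1 := by gcongr
      _ = _ := by ring
  have h3 := abs_le.1 (key _ _ _ _ h0' hle h0'' hle' h1 h2)
  rw [hprod] at h0
  rw [empQ, abs_le]
  constructor <;> linarith

end Trees

end TSP

namespace TSP

/-! ### Growth of the penalty against the divergence bound -/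

section Penalty

/-- Factor `u - v = (√u - √v) (√u + √v)` and use `√v ≤ √u`. -/
theorem sub_div_two_sqrt_le {u v : ℝ} (hv : 0 ≤ v) (hvu : v ≤ u) (hu : 0 < u) :
    (u - v) / (2 * √u) ≤ √u - √v := by
  have h1 := Real.sq_sqrt hv
  have h2 := Real.sq_sqrt hu.le
  have h3 := Real.sqrt_le_sqrt hvu
  have h4 := Real.sqrt_pos.2 hu
  rw [div_le_iff₀ (by positivity)]
  nlinarith

theorem penalty_nonneg (n : ℕ) {b : ℝ} (hb : 0 < b) (d : ℕ) (δ : ℝ) (k : ℕ) :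
    0 ≤ penalty n b d δ k := by
  unfold penalty epsC
  positivity

/-- The increments of the penalty, in terms of a bound `s ^ 2 * n ^ (3 / 5)` of the radicand. -/
theorem le_penalty_sub_penalty {n : ℕ} (hn : 0 < n) {b δ s : ℝ} {d k : ℕ} (hb : 0 < b) (hs : 0 < s)
    (hδ : 0 < δ) (hδb : δ * b ≤ 8) (hk : 2 ≤ k) (hkb : k * b ≤ 1)
    (hG : Real.log (8 / (δ * b)) + 1 / b * ((d + 1) * Real.log 2 + d * Real.log n) ≤
      s ^ 2 * (n : ℝ) ^ (3 / 5 : ℝ)) :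
    k * (3 / s * (n : ℝ) ^ (-(4 / 5) : ℝ) / b) ≤ penalty n b d δ k - penalty n b d δ 1 := by
  have hn0 : (0 : ℝ) < n := by exact_mod_cast hn
  have hk2 : (2 : ℝ) ≤ k := by exact_mod_cast hk
  have hlog2 : (1 / 2 : ℝ) < Real.log 2 := by linarith [Real.log_two_gt_d9]
  have hlogn : 0 ≤ Real.log n := Real.log_natCast_nonneg n
  unfold penalty epsC
  set a := Real.log (8 / (δ * b))
  have ha : 0 ≤ a := Real.log_nonneg ((one_le_div (by positivity)).2 hδb)
  set M := ((d : ℝ) + 1) * Real.log 2 + d * Real.log n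
  have hM : 1 / 2 ≤ M := by
    have h1 : 0 ≤ (d : ℝ) * Real.log 2 := by positivity
    have h2 : 0 ≤ (d : ℝ) * Real.log n := by positivity
    simp only [M]
    linarith
  have hu : 0 < a + k * M := by nlinarith
  have huG : a + k * M ≤ s ^ 2 * (n : ℝ) ^ (3 / 5 : ℝ) := by
    refine le_trans ?_ hG
    have : (k : ℝ) ≤ 1 / b := (le_div_iff₀ hb).2 hkb
    gcongr
  have hsq : √(a + k * M) ≤ s * (n : ℝ) ^ (3 / 10 : ℝ) := by
    refine Real.sqrt_le_iff.2 ⟨by positivity, huG.trans (le_of_eq ?_)⟩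
    rw [mul_pow, ← Real.rpow_natCast ((n : ℝ) ^ (3 / 10 : ℝ)), ← Real.rpow_mul hn0.le]
    norm_num
  have hv : 0 ≤ a + ((1 : ℕ) : ℝ) * M := by
    push_cast
    linarith
  have hvu : a + ((1 : ℕ) : ℝ) * M ≤ a + k * M := by
    push_cast
    nlinarith
  have hdiff := sub_div_two_sqrt_le hv hvu hu
  -- The difference is `(k - 1) M`, with `k - 1 ≥ k / 2` and `M ≥ 1 / 2`.
  have hnum : (k : ℝ) / 4 ≤ (a + k * M) - (a + ((1 : ℕ) : ℝ) * M) := by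
    push_cast
    nlinarith
  have hsqn : √(n : ℝ) = (n : ℝ) ^ (1 / 2 : ℝ) := Real.sqrt_eq_rpow _
  have hpow : (n : ℝ) ^ (-(4 / 5) : ℝ) = 1 / ((n : ℝ) ^ (1 / 2 : ℝ) * (n : ℝ) ^ (3 / 10 : ℝ)) := by
    rw [← Real.rpow_add hn0, one_div, ← Real.rpow_neg hn0.le]
    norm_num
  rw [← mul_sub, hsqn]
  have h24 : (24 : ℝ) ≤ 24 * √2 := by
    have : (1 : ℝ) ≤ √2 := Real.one_le_sqrt.2 (by norm_num)
    linarith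
  -- The constant is `24 · (1/4) · (1/2) = 3`, and the exponent `4/5` is `1/2 + 3/10`.
  calc (k : ℝ) * (3 / s * (n : ℝ) ^ (-(4 / 5) : ℝ) / b)
      = 24 / (b * (n : ℝ) ^ (1 / 2 : ℝ)) * ((k / 4) / (2 * (s * (n : ℝ) ^ (3 / 10 : ℝ)))) := by
        rw [hpow]
        field_simp
        norm_num
    _ ≤ 24 * √2 / (b * (n : ℝ) ^ (1 / 2 : ℝ)) *
        (((a + k * M) - (a + ((1 : ℕ) : ℝ) * M)) / (2 * √(a + k * M))) := by
        gcongr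
    _ ≤ _ := by gcongr

theorem isLittleO_natCast_rpow {s t : ℝ} (h : s < t) :
    (fun n : ℕ => (n : ℝ) ^ s) =o[atTop] fun n : ℕ => (n : ℝ) ^ t := by
  have hpos : ∀ᶠ n : ℕ in atTop, (0 : ℝ) < n := by
    filter_upwards [eventually_gt_atTop 0] with n hn using by exact_mod_cast hn
  refine (isLittleO_iff_tendsto' ?_).2 ?_
  · filter_upwards [hpos] with n hn h0 using absurd h0 (Real.rpow_pos_of_pos hn t).ne'
  · refine ((tendsto_rpow_neg_atTop (sub_pos.2 h)).comp tendsto_natCast_atTop_atTop).congr' ?_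
    filter_upwards [hpos] with n hn
    rw [Function.comp_apply, neg_sub, Real.rpow_sub hn]

theorem isLittleO_const_natCast_rpow (c : ℝ) {t : ℝ} (h : 0 < t) :
    (fun _ : ℕ => c) =o[atTop] fun n : ℕ => (n : ℝ) ^ t :=
  isLittleO_const_left.2 (.inr (tendsto_norm_atTop_atTop.comp
    ((tendsto_rpow_atTop h).comp tendsto_natCast_atTop_atTop)))

theorem isLittleO_log_natCast_rpow {t : ℝ} (h : 0 < t) :
    (fun n : ℕ => Real.log n) =o[atTop] fun n : ℕ => (n : ℝ) ^ t :=
  (isLittleO_log_rpow_atTop h).comp_tendsto tendsto_natCast_atTop_atTop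

variable {l : ℝ} {b δ : ℕ → ℝ}

/-- The number of leaves is replaced by its bound `1 / b n`. The orders are `n^(1/3)` from `log (1 /
δ n)` and at most `n^(l + 1/5)` from the rest, logarithms being absorbed in `n^(1/5)`; both
exponents are below `3/5`. -/
theorem eventually_radicand_le (hl0 : 0 < l) (hl1 : l < 1 / 3) (hb0 : ∀ n, 1 ≤ n → 0 < b n)
    (hδ0 : ∀ n, 1 ≤ n → 0 < δ n) (hb : b =Θ[atTop] fun n : ℕ => (n : ℝ) ^ (-l))
    (hδ' : (fun n => 1 / δ n) =O[atTop] fun n : ℕ => Real.exp ((n : ℝ) ^ (1 / 3 : ℝ)))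
    (d : ℕ) {θ : ℝ} (hθ : 0 < θ) :
    ∀ᶠ n : ℕ in atTop, Real.log (8 / (δ n * b n)) +
      1 / b n * ((d + 1) * Real.log 2 + d * Real.log n) ≤ θ * (n : ℝ) ^ (3 / 5 : ℝ) := by
  obtain ⟨C, hC0, hC⟩ := hδ'.exists_pos
  have hbinv : (fun n => 1 / b n) =O[atTop] fun n : ℕ => (n : ℝ) ^ l := by
    simp only [one_div]
    refine (IsBigO.inv_rev hb.2 ?_).congr_right fun n => ?_
    · filter_upwards [eventually_gt_atTop 0] with n hn h
      have hn0 : (0 : ℝ) < n := by exact_mod_cast hn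
      exact absurd h (Real.rpow_pos_of_pos hn0 _).ne'
    · rw [Real.rpow_neg n.cast_nonneg, inv_inv]
  -- The extra `1` makes room for `log (1 / b n) ≤ 1 / b n`.
  have hM : (fun n : ℕ => 1 + ((d + 1) * Real.log 2 + d * Real.log n)) =O[atTop]
      fun n : ℕ => (n : ℝ) ^ (1 / 5 : ℝ) :=
    ((isLittleO_const_natCast_rpow _ (by norm_num)).add
      ((isLittleO_const_natCast_rpow _ (by norm_num)).add
        ((isLittleO_log_natCast_rpow (by norm_num)).const_mul_left _))).isBigO
  have hprod : (fun n : ℕ => 1 / b n * (1 + ((d + 1) * Real.log 2 + d * Real.log n))) =o[atTop]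
      fun n : ℕ => (n : ℝ) ^ (3 / 5 : ℝ) := by
    refine (hbinv.mul hM).trans_isLittleO ?_
    refine IsLittleO.congr' (isLittleO_natCast_rpow (s := l + 1 / 5) (t := 3 / 5) (by linarith)) ?_
      .rfl
    filter_upwards [eventually_gt_atTop 0] with n hn
    have hn0 : (0 : ℝ) < n := by exact_mod_cast hn
    exact Real.rpow_add hn0 _ _
  have htot := (((isLittleO_const_natCast_rpow (Real.log 8 + Real.log C) (t := 3 / 5)
    (by norm_num)).add (isLittleO_natCast_rpow (s := 1 / 3) (t := 3 / 5) (by norm_num))).add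
      hprod).bound hθ
  filter_upwards [htot, hC.bound, eventually_ge_atTop 1] with n h1 h2 hn
  have hbn := hb0 n hn
  have hδn := hδ0 n hn
  rw [Real.norm_of_nonneg (Real.rpow_nonneg n.cast_nonneg _)] at h1
  refine le_trans ?_ ((le_abs_self _).trans h1)
  rw [Real.norm_of_nonneg (by positivity), Real.norm_of_nonneg (by positivity)] at h2
  have h3 : Real.log (1 / δ n) ≤ Real.log C + (n : ℝ) ^ (1 / 3 : ℝ) := by
    have := Real.log_le_log (by positivity) h2
    rwa [Real.log_mul hC0.ne' (Real.exp_pos _).ne', Real.log_exp] at this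
  have h4 : Real.log (1 / b n) ≤ 1 / b n := by
    linarith [Real.log_le_sub_one_of_pos (show 0 < 1 / b n by positivity)]
  have h5 : Real.log (8 / (δ n * b n)) = Real.log 8 + Real.log (1 / δ n) + Real.log (1 / b n) := by
    rw [← Real.log_mul (by norm_num) (by positivity), ← Real.log_mul (by positivity) (by positivity)]
    congr 1
    field_simp
  rw [h5]
  linarith

/-- Eventually a uniform deviation of order `n ^ (-2 / 5)` is dominated by the penalties. -/
theorem eventually_penalty_dominates (hl0 : 0 < l) (hl1 : l < 1 / 3)
    (hb0 : ∀ n, 1 ≤ n → 0 < b n) (hδ0 : ∀ n, 1 ≤ n → 0 < δ n)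
    (hb : b =Θ[atTop] fun n : ℕ => (n : ℝ) ^ (-l)) (hδ : Tendsto δ atTop (nhds 0))
    (hδ' : (fun n => 1 / δ n) =O[atTop] fun n : ℕ => Real.exp ((n : ℝ) ^ (1 / 3 : ℝ)))
    (d : ℕ) {e : ℕ → ℝ} (he : e =O[atTop] fun n : ℕ => (n : ℝ) ^ (-(2 / 5) : ℝ)) :
    ∀ᶠ n : ℕ in atTop, b n ≤ 1 ∧ e n ≤ b n / 2 ∧ ∀ k : ℕ, 2 ≤ k → k * b n ≤ 1 →
      k * (2 * e n ^ 2 / b n) < penalty n (b n) d (δ n) k - penalty n (b n) d (δ n) 1 := by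
  obtain ⟨C, hC0, hC⟩ := he.exists_pos
  have hbl : Tendsto b atTop (nhds 0) := hb.1.trans_tendsto
    ((tendsto_rpow_neg_atTop hl0).comp tendsto_natCast_atTop_atTop)
  -- This holds because `l < 1/3 < 2/5`.
  have heb : e =o[atTop] b :=
    (he.trans_isLittleO (isLittleO_natCast_rpow (by linarith))).trans_isBigO hb.2
  -- With `s = 1 / (C² + 1)` the increment has constant `3 / s = 3 (C² + 1)`, which exceeds the `2
  -- C²` of the divergence bound.
  have hs : 0 < 1 / (C ^ 2 + 1) := by positivity
  filter_upwards [hC.bound, hbl.eventually_le_const one_pos, heb.bound (half_pos one_pos),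
    hδ.eventually_le_const one_pos, eventually_ge_atTop 1,
    eventually_radicand_le hl0 hl1 hb0 hδ0 hb hδ' d (pow_pos hs 2)] with n h1 h2 h3 h4 hn h5
  have hbn := hb0 n hn
  have hδn := hδ0 n hn
  have hn0 : (0 : ℝ) < n := by exact_mod_cast hn
  refine ⟨h2, ?_, fun k hk hkb => ?_⟩
  · rw [Real.norm_of_nonneg hbn.le] at h3
    linarith [(le_abs_self (e n)).trans h3]
  · refine lt_of_lt_of_le ?_ (le_penalty_sub_penalty hn hbn hs hδn (by nlinarith) hk hkb h5)
    have hk0 : (0 : ℝ) < k := by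
      have : 0 < k := by omega
      exact_mod_cast this
    rw [Real.norm_of_nonneg (Real.rpow_nonneg n.cast_nonneg _)] at h1
    have hsq : e n ^ 2 ≤ C ^ 2 * (n : ℝ) ^ (-(4 / 5) : ℝ) := by
      calc e n ^ 2 = |e n| ^ 2 := (sq_abs _).symm
        _ ≤ (C * (n : ℝ) ^ (-(2 / 5) : ℝ)) ^ 2 := by
            gcongr
            exact h1
        _ = _ := by
            rw [mul_pow, ← Real.rpow_natCast ((n : ℝ) ^ (-(2 / 5) : ℝ)), ← Real.rpow_mul hn0.le]
            norm_num
    have hp : 0 < (n : ℝ) ^ (-(4 / 5) : ℝ) := Real.rpow_pos_of_pos hn0 _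
    refine mul_lt_mul_of_pos_left (div_lt_div_of_pos_right ?_ hbn) hk0
    calc 2 * e n ^ 2 ≤ 2 * (C ^ 2 * (n : ℝ) ^ (-(4 / 5) : ℝ)) := by gcongr
      _ < 3 * (C ^ 2 + 1) * (n : ℝ) ^ (-(4 / 5) : ℝ) := by nlinarith [sq_nonneg C]
      _ = _ := by rw [div_div_eq_mul_div, div_one]

/-- This is `3 ε` of `abs_empP_sub_empQ_le`, with `ε` the Hoeffding rate plus the bracket width; for
`c = p + q` the width is of smaller order. -/
theorem isBigO_deviation (c : ℝ) :
    (fun n : ℕ => 3 * ((n : ℝ) ^ (-(2 / 5) : ℝ) + c * (1 / n + 1 / n))) =O[atTop]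
      fun n : ℕ => (n : ℝ) ^ (-(2 / 5) : ℝ) := by
  have h : (fun n : ℕ => (1 : ℝ) / n) =O[atTop] fun n : ℕ => (n : ℝ) ^ (-(2 / 5) : ℝ) :=
    (isLittleO_natCast_rpow (s := -1) (by norm_num)).isBigO.congr_left fun n => by
      rw [Real.rpow_neg_one, one_div]
  exact ((isBigO_refl _ _).add ((h.add h).const_mul_left c)).const_mul_left 3

theorem lastNontrivial_lt_top {T : ℕ → BinaryTree Unit} (h : ∀ᶠ n in atTop, T n = .nil) :
    lastNontrivial T < ⊤ := by
  obtain ⟨N, hN⟩ := eventually_atTop.1 h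
  refine lt_of_le_of_lt (sSup_le ?_) (ENat.natCast_lt_top N)
  rintro _ ⟨m, ⟨-, hm⟩, rfl⟩
  by_contra! hlt
  have hlt' : N < m := by exact_mod_cast hlt
  rw [hN m hlt'.le, BinaryTree.numLeaves] at hm
  exact lt_irrefl _ hm

end Penalty

end TSP

/-! ### Main theorem -/

theorem lemma3 {p q : ℕ} {Ω : Type*} [MeasurableSpace Ω] (μ : Measure Ω) [IsProbabilityMeasure μ]
    -- the law of `(X, Y)`, under which the components are independent
    (P : Measure (TSP.Pt p q)) (hP : TSP.IsIndependentLaw P)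
    -- the i.i.d. samples
    (Z : ℕ → Ω → TSP.Pt p q) (hZm : ∀ i, Measurable (Z i)) (hZi : iIndepFun Z μ)
    (hZP : ∀ i, μ.map (Z i) = P)
    -- the parameters
    (l : ℝ) (hl0 : 0 < l) (hl1 : l < 1 / 3)
    (b δ : ℕ → ℝ) (hb0 : ∀ n, 1 ≤ n → 0 < b n) (hδ0 : ∀ n, 1 ≤ n → 0 < δ n)
    (hb : b =Θ[atTop] fun n : ℕ => (n : ℝ) ^ (-l))
    (hδ : Summable δ)
    (hδ' : (fun n => 1 / δ n) =O[atTop] fun n : ℕ => Real.exp ((n : ℝ) ^ (1 / 3 : ℝ)))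
    -- the penalties; the one of the trivial tree may also be set to zero
    (r : ℕ → ℕ → ℝ)
    (hr : ∀ n k, 2 ≤ k → r n k = TSP.penalty n (b n) (p + q) (δ n) k)
    (hr1 : ∀ n, r n 1 = TSP.penalty n (b n) (p + q) (δ n) 1 ∨ r n 1 = 0)
    -- any rule that selects the coordinates, and any selection of a solution
    (coord : (n : ℕ) → (Fin n → TSP.Pt p q) → List Bool → Fin p ⊕ Fin q)
    (That : (n : ℕ) → (Fin n → TSP.Pt p q) → BinaryTree Unit)
    (hThat : ∀ n, 1 ≤ n → ∀ z : Fin n → TSP.Pt p q,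
      TSP.IsSolution (b n) (r n) z (coord n z) (That n z)) :
    (∀ᵐ ω ∂μ,
      TSP.lastNontrivial (fun n => That n (TSP.initial (fun i => Z i ω) n)) < ⊤) ∧
    (∀ᵐ ω ∂μ, ∀ᶠ n : ℕ in atTop,
      TSP.partition (TSP.initial (fun i => Z i ω) n)
        (coord n (TSP.initial (fun i => Z i ω) n))
        (That n (TSP.initial (fun i => Z i ω) n)) = [TSP.Cell.root p q]) := by
  have : IsProbabilityMeasure P := hZP 0 ▸ Measure.isProbabilityMeasure_map (hZm 0).aemeasurable
  have hnil : ∀ᵐ ω ∂μ, ∀ᶠ n : ℕ in atTop,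
      That n (TSP.initial (fun i => Z i ω) n) = .nil := by
    filter_upwards [TSP.ae_eventually_abs_empP_box_sub_le hZm hZi hZP] with ω hω
    filter_upwards [hω, eventually_ge_atTop 1, TSP.eventually_penalty_dominates hl0 hl1 hb0 hδ0 hb
      hδ.tendsto_atTop_zero hδ' (p + q) (TSP.isBigO_deviation (p + q))] with n hdev hn hpen
    obtain ⟨hb1, he, hk⟩ := hpen
    refine TSP.IsSolution.eq_nil _ _ hn (hb0 n hn) hb1 he
      (fun A hA => TSP.abs_empP_sub_empQ_le _ hP hn hdev hA) (fun k hk2 hkb => ?_) (hThat n hn _)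
    rw [hr n k hk2]
    -- Both admissible values of `r n 1` are at most the penalty of one leaf, so the gap proved for
    -- that penalty suffices.
    refine (hk k hk2 hkb).trans_le (sub_le_sub_left ?_ _)
    rcases hr1 n with h | h
    · exact h.le
    · exact h.trans_le (TSP.penalty_nonneg n (hb0 n hn) _ _ _)
  constructor
  · filter_upwards [hnil] with ω hω using TSP.lastNontrivial_lt_top hω
  · filter_upwards [hnil] with ω hω
    filter_upwards [hω] with n hn
    rw [hn, TSP.partition, TSP.cellsFrom]
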